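/- **Crossed cube.** Two-bit strings $x_1x_0$ and $y_1y_0$ are *pair related*, $x_1x_0\sim y_1y_0$, if $(x_1x_0,y_1y_0)\in\{(00,00),(10,10),(01,11),(11,01)\}$. The crossed cube $CQ_1$ is $K_2$ with vertices $0,1$. For $n\ge2$, the vertices of $CQ_n$ are the binary strings $u_{n-1}\ldots u_0$; $CQ_n$ consists of two copies $CQ^0_{n-1}$, $CQ^1_{n-1}$ of $CQ_{n-1}$, obtained by prefixing the strings with $0$ and $1$ respectively, and of the edges between those $u=0u_{n-2}\ldots u_0$ and $v=1v_{n-2}\ldots v_0$ for which $u_{n-2}=v_{n-2}$ if $n$ is even, and $u_{2i+1}u_{2i}\sim v_{2i+1}v_{2i}$ for all $0\le i<\lfloor\frac{n-1}{2}\rfloor$. **BCDC network.** The vertices of $B_n$ are unordered pairs $[x,y]$ of binary strings of length $n$. $B_2$ is the $4$-cycle $[00,01],[01,11],[10,11],[00,10]$ (in this cyclic order). For $n\ge3$, let $B^0_{n-1}$ and $B^1_{n-1}$ be the copies of $B_{n-1}$ obtained by prefixing both strings of every vertex with $0$ and $1$ respectively, and let $S_n$ be the set of the pairs $[a,b]$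 with $a\in V(CQ^0_{n-1})$, $b\in V(CQ^1_{n-1})$ and $ab\in E(CQ_n)$. Then $B_n$ has the vertex set $V(B^0_{n-1})\cup V(B^1_{n-1})\cup S_n$, and its edges are those of $B^0_{n-1}$ and $B^1_{n-1}$ together with those joining each $[c,d]\in S_n$, where $c\in V(CQ^0_{n-1})$ and $d\in V(CQ^1_{n-1})$, to all vertices of $B^0_{n-1}$ that contain $c$ and to all vertices of $B^1_{n-1}$ that contain $d$. **Structure connectivity.** For a set $\mathcal F$ of subgraphs of a graph $G$ let $G-\mathcal F$ be the graph obtained from $G$ by deleting all vertices of all members of $\mathcal F$; $\mathcal F$ is a *subgraph cut* if $G-\mathcal F$ is disconnected or has exactly one vertex. For a connected graph $H$, $\kappa(G;H)$ (respectively $\kappa^s(G;H)$) is the smallest number of members of a subgraph cut all of whose members are isomorphic to $H$ (respectively to connected subgraphs of $H$). Let $P_k$ be the path with $k$ vertices. **Theorem.** For all integers $n\ge4$ and $4\le k\le 2n-1$, $$\kappa(B_n;P_k)=\kappa^s(B_n;P_k)=\begin{cases}\dfrac{2n-2}{k},&\text{if }4\le k\le n-1\text{ and }k\mid n-1,\\[2mm]\left\lceil\dfrac{2n-1}{k}\right\rceil,&\text{otherwise.}\end{cases}$$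 -/

import Mathlib

/-! Crossed cubes. A binary string `x_{n-1} … x_1 x_0` is a function `x : Fin n → Bool`
whose value at `i` is the bit `x_i`. -/

/-- The binary string obtained from `x` by writing the bit `b` in front of it
(`b` becomes the leading bit, of index `n`). -/
def prefixBit {n : ℕ} (b : Bool) (x : Fin n → Bool) : Fin (n + 1) → Bool :=
  Fin.snoc (α := fun _ => Bool) x b

/-- The two-bit string `x₁x₀`. -/
def bits2 (x₁ x₀ : Bool) : Fin 2 → Bool := ![x₀, x₁]

/-- The two-bit strings `x₁x₀` and `y₁y₀` are pair related: the pair `(x₁x₀, y₁y₀)` is one of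
`(00, 00)`, `(10, 10)`, `(01, 11)`, `(11, 01)`. -/
def PairRelated (x₁ x₀ y₁ y₀ : Bool) : Prop :=
  ((x₁, x₀), (y₁, y₀)) ∈
    ({((false, false), (false, false)), ((true, false), (true, false)),
      ((false, true), (true, true)), ((true, true), (false, true))} :
      Set ((Bool × Bool) × (Bool × Bool)))

theorem PairRelated.symm {x₁ x₀ y₁ y₀ : Bool} (h : PairRelated x₁ x₀ y₁ y₀) :
    PairRelated y₁ y₀ x₁ x₀ := by
  revert h
  cases x₁ <;> cases x₀ <;> cases y₁ <;> cases y₀ <;> simp [PairRelated]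

/-- The condition on the non-leading bits under which two vertices `u`, `v` of the
`(n + 2)`-dimensional crossed cube with different leading bits are adjacent. -/
def CrossRelated {n : ℕ} (u v : Fin (n + 2) → Bool) : Prop :=
  (Even (n + 2) → u ⟨n, by omega⟩ = v ⟨n, by omega⟩) ∧
    ∀ (i : ℕ) (_ : i < (n + 2 - 1) / 2),
      PairRelated (u ⟨2 * i + 1, by omega⟩) (u ⟨2 * i, by omega⟩)
        (v ⟨2 * i + 1, by omega⟩) (v ⟨2 * i, by omega⟩)

/-- The `n`-dimensional crossed cube `CQ_n`: `CQ_1 = K_2`, and for `n ≥ 2` it consists of two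
copies of `CQ_{n-1}` (leading bit `0` and leading bit `1`) and cross edges. The case `n = 0`
is a single vertex. -/
def crossedCube : (n : ℕ) → SimpleGraph (Fin n → Bool)
  | 0 => ⊥
  | 1 => ⊤
  | n + 2 =>
    { Adj := fun u v =>
        (u (Fin.last (n + 1)) = v (Fin.last (n + 1)) ∧
          (crossedCube (n + 1)).Adj (Fin.init u) (Fin.init v)) ∨
        (u (Fin.last (n + 1)) ≠ v (Fin.last (n + 1)) ∧ CrossRelated u v)
      symm := ⟨by
        rintro u v (⟨h, h'⟩ | ⟨h, h1, h2⟩)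
        · exact Or.inl ⟨h.symm, h'.symm⟩
        · exact Or.inr ⟨h.symm, fun he => (h1 he).symm, fun i hi => (h2 i hi).symm⟩⟩
      loopless := ⟨by
        rintro u (⟨_, h⟩ | ⟨h, _⟩)
        · exact (crossedCube (n + 1)).irrefl h
        · exact h rfl⟩ }

/-! BCDC networks. A server `[x, y]` is an unordered pair of binary strings. -/

/-- Prefixing a server `[x, y]` with the bit `b`: the server `[bx, by]`. -/
def prefixServer {n : ℕ} (b : Bool) (e : Sym2 (Fin n → Bool)) : Sym2 (Fin (n + 1) → Bool) :=
  e.map (prefixBit b)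

/-- The set `S_{n+1}` of the servers `[0x, 1y]` with `0x` adjacent to `1y` in `CQ_{n+1}`. -/
def crossServers (n : ℕ) : Set (Sym2 (Fin (n + 1) → Bool)) :=
  {e | ∃ x y : Fin n → Bool,
    (crossedCube (n + 1)).Adj (prefixBit false x) (prefixBit true y) ∧
      e = s(prefixBit false x, prefixBit true y)}

/-- The vertex set of the BCDC network `B_n`, `n ≥ 2` (empty for `n < 2`). -/
def bcdcVerts : (n : ℕ) → Set (Sym2 (Fin n → Bool))
  | 0 => ∅
  | 1 => ∅
  | 2 => {s(bits2 false false, bits2 false true), s(bits2 false false, bits2 true false),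
      s(bits2 false true, bits2 true true), s(bits2 true false, bits2 true true)}
  | n + 3 => prefixServer false '' bcdcVerts (n + 2) ∪ prefixServer true '' bcdcVerts (n + 2) ∪
      crossServers (n + 2)

/-- The edges of the BCDC network `B_n`, as a graph on all unordered pairs of strings (every
edge has both ends in `bcdcVerts n`). `B_2` is the 4-cycle
`[00,01], [01,11], [10,11], [00,10]`. For larger `n` the edges are those of the two prefixed
copies of `B_{n-1}`, and those that join a cross server `[0x, 1y]` to the servers of the
`0`-copy that contain `0x` and to the servers of the `1`-copy that contain `1y`. -/
def bcdcEdges : (n : ℕ) → SimpleGraph (Sym2 (Fin n → Bool))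
  | 0 => ⊥
  | 1 => ⊥
  | 2 => SimpleGraph.fromEdgeSet
      {s(s(bits2 false false, bits2 false true), s(bits2 false true, bits2 true true)),
       s(s(bits2 false true, bits2 true true), s(bits2 true false, bits2 true true)),
       s(s(bits2 true false, bits2 true true), s(bits2 false false, bits2 true false)),
       s(s(bits2 false false, bits2 true false), s(bits2 false false, bits2 false true))}
  | n + 3 => SimpleGraph.fromRel fun e f =>
      (∃ (b : Bool) (e' f' : Sym2 (Fin (n + 2) → Bool)), (bcdcEdges (n + 2)).Adj e' f' ∧
        e = prefixServer b e' ∧ f = prefixServer b f') ∨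
      (∃ x y : Fin (n + 2) → Bool,
        (crossedCube (n + 3)).Adj (prefixBit false x) (prefixBit true y) ∧
        f = s(prefixBit false x, prefixBit true y) ∧
        ((e ∈ prefixServer false '' bcdcVerts (n + 2) ∧ prefixBit false x ∈ e) ∨
         (e ∈ prefixServer true '' bcdcVerts (n + 2) ∧ prefixBit true y ∈ e)))

/-- The `n`-dimensional BCDC network `B_n`, `n ≥ 2`. -/
def bcdc (n : ℕ) : SimpleGraph (bcdcVerts n) := (bcdcEdges n).induce (bcdcVerts n)

/-! Structure connectivity and substructure connectivity. -/

/-- The set `V(F)` of all vertices of the members of a set `F` of subgraphs. -/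
def coveredVerts {V : Type*} {G : SimpleGraph V} (F : Set G.Subgraph) : Set V :=
  {v | ∃ K ∈ F, v ∈ K.verts}

/-- `F` is a subgraph cut of `G`: deleting the vertices of all members of `F` leaves a
disconnected graph (two vertices that no walk joins) or a graph with exactly one vertex. -/
def IsSubgraphCut {V : Type*} (G : SimpleGraph V) (F : Set G.Subgraph) : Prop :=
  ¬ (G.induce (coveredVerts F)ᶜ).Preconnected ∨ ∃ v, (coveredVerts F)ᶜ = {v}

/-- `F` is an `H`-structure cut of `G`: a subgraph cut whose members are all isomorphic
to `H`. -/
def IsStructureCut {V W : Type*} (G : SimpleGraph V) (H : SimpleGraph W)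
    (F : Set G.Subgraph) : Prop :=
  IsSubgraphCut G F ∧ ∀ K ∈ F, Nonempty (K.coe ≃g H)

/-- `F` is an `H`-substructure cut of `G`: a subgraph cut whose members are all isomorphic to
connected subgraphs of `H`. -/
def IsSubstructureCut {V W : Type*} (G : SimpleGraph V) (H : SimpleGraph W)
    (F : Set G.Subgraph) : Prop :=
  IsSubgraphCut G F ∧
    ∀ K ∈ F, ∃ L : H.Subgraph, L.Connected ∧ Nonempty (K.coe ≃g L.coe)

/-- The `H`-structure connectivity `κ(G; H)`: the smallest size of an `H`-structure cut of `G`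
(`⊤` if there is none). -/
noncomputable def structureConnectivity {V W : Type*} (G : SimpleGraph V)
    (H : SimpleGraph W) : ℕ∞ :=
  ⨅ (F : Set G.Subgraph) (_ : IsStructureCut G H F), F.encard

/-- The `H`-substructure connectivity `κˢ(G; H)`: the smallest size of an `H`-substructure cut
of `G` (`⊤` if there is none). -/
noncomputable def substructureConnectivity {V W : Type*} (G : SimpleGraph V)
    (H : SimpleGraph W) : ℕ∞ :=
  ⨅ (F : Set G.Subgraph) (_ : IsSubstructureCut G H F), F.encard

/-! The servers of `B_n` are the edges of the crossed cube, and two of them are adjacent when they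
share an end. So `B_n` is the line graph of `CQ_n` (`bcdcVerts_eq_edgeSet`, `bcdcEdges_adj`), an
`n`-regular triangle-free graph.

Lower bound (`le_ncard_mul_of_isSubstructureCut`). A set `C` of edges that disconnects the line
graph contains the edge boundary of a set `S` with at least two vertices inside and outside. By
`crossedCube_edgeBoundary` this boundary has at least `2n - 1` edges, or it has `2n - 2` and `S` or
its complement consists of the ends of an edge `uv`. Now `m` members cover at most `mk` vertices of
the line graph. If `mk < 2n - 1`, then `mk = 2n - 2` and `C` is exactly the set of edges that meet
`uv`. As there are no triangles, the `n - 1` edges at `u` are not adjacent to the `n - 1` edges at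
`v`, so each member lies on one side, and counting on each side gives `k ∣ n - 1`.

Upper bound (`structureConnectivity_le_of_windows`). For a 4-cycle `uvba`, the edges at `u`, then
`ab`, then the edges at `v` form a path on `2n - 1` vertices of the line graph. It avoids `uv` and
contains all neighbours of `uv`. Windows of `k` consecutive vertices isolate `uv`; only the middle
vertex `ab` may stay uncovered, which saves something exactly when `k ∣ n - 1`. -/

/-! ### Adjacency, regularity and triangle-freeness of crossed cubes. -/

/-- The bit `j` of the only neighbour of `bx` with the other leading bit in a crossed cube. -/
def twist {n : ℕ} (x : Fin n → Bool) : Fin n → Bool := fun j =>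
  if (j : ℕ) % 2 = 1 then xor (x j) (x ⟨(j : ℕ) - 1, by omega⟩) else x j

theorem twist_twist {n : ℕ} (x : Fin n → Bool) : twist (twist x) = x := by
  funext j
  unfold twist
  by_cases h : (j : ℕ) % 2 = 1
  · have h2 : ¬ ((j : ℕ) - 1) % 2 = 1 := by omega
    simp [h, h2]
  · simp [h]

theorem twist_injective {n : ℕ} : Function.Injective (twist (n := n)) :=
  Function.LeftInverse.injective twist_twist

@[simp] theorem prefixBit_last {n : ℕ} (b : Bool) (x : Fin n → Bool) :
    prefixBit b x (Fin.last n) = b := by simp [prefixBit]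

@[simp] theorem init_prefixBit {n : ℕ} (b : Bool) (x : Fin n → Bool) :
    (Fin.init (prefixBit b x) : Fin n → Bool) = x := by simp [prefixBit]

theorem prefixBit_lt {n : ℕ} (b : Bool) (x : Fin n → Bool) (i : ℕ) (h : i < n) :
    prefixBit b x ⟨i, by omega⟩ = x ⟨i, h⟩ :=
  congrFun (init_prefixBit b x) ⟨i, h⟩

theorem prefixBit_inj {n : ℕ} {b c : Bool} {x y : Fin n → Bool} :
    prefixBit b x = prefixBit c y ↔ b = c ∧ x = y := by
  refine ⟨fun h => ⟨?_, ?_⟩, by rintro ⟨rfl, rfl⟩; rfl⟩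
  · simpa using congrFun h (Fin.last n)
  · simpa using congrArg (fun z => (Fin.init z : Fin n → Bool)) h

theorem prefixBit_injective {n : ℕ} (b : Bool) : Function.Injective (prefixBit (n := n) b) :=
  fun _ _ h => (prefixBit_inj.1 h).2

theorem exists_prefixBit {n : ℕ} (u : Fin (n + 1) → Bool) :
    ∃ b x, u = prefixBit b x :=
  ⟨u (Fin.last n), Fin.init u, by simp [prefixBit]⟩

theorem pairRelated_iff {x₁ x₀ y₁ y₀ : Bool} :
    PairRelated x₁ x₀ y₁ y₀ ↔ y₀ = x₀ ∧ y₁ = xor x₁ x₀ := by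
  cases x₁ <;> cases x₀ <;> cases y₁ <;> cases y₀ <;> simp [PairRelated]

/-- Even bits are copied and each odd bit gets the bit below it added, so the neighbour across is
determined: the cross edges form a perfect matching. -/
theorem crossRelated_prefixBit {n : ℕ} (b c : Bool) (x y : Fin (n + 1) → Bool) :
    CrossRelated (prefixBit b x) (prefixBit c y) ↔ y = twist x := by
  simp only [CrossRelated, pairRelated_iff]
  constructor
  · rintro ⟨h1, h2⟩
    funext ⟨j, hj⟩
    by_cases hodd : j % 2 = 1
    · have := (h2 (j / 2) (by omega)).2
      have e1 : 2 * (j / 2) + 1 = j := by omega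
      have e2 : 2 * (j / 2) = j - 1 := by omega
      simp only [e1] at this
      simp only [e2] at this
      rw [prefixBit_lt _ _ _ hj, prefixBit_lt _ _ _ hj, prefixBit_lt _ _ _ (by omega)] at this
      simp [twist, hodd, this]
    -- For even `n` the bit `n` belongs to no pair; it is covered by the parity clause of
    -- `CrossRelated`.
    · by_cases hn : j = n
      · subst hn
        have := h1 (by rw [Nat.even_iff]; omega)
        rw [prefixBit_lt _ _ _ hj, prefixBit_lt _ _ _ hj] at this
        simp [twist, hodd, this]
      · have := (h2 (j / 2) (by omega)).1
        have e2 : 2 * (j / 2) = j := by omega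
        simp only [e2] at this
        rw [prefixBit_lt _ _ _ hj, prefixBit_lt _ _ _ hj] at this
        simp [twist, hodd, this]
  · rintro rfl
    refine ⟨fun he => ?_, fun i hi => ⟨?_, ?_⟩⟩
    · rw [Nat.even_iff] at he
      rw [prefixBit_lt _ _ _ (by omega), prefixBit_lt _ _ _ (by omega)]
      have : ¬ n % 2 = 1 := by omega
      simp [twist, this]
    · rw [prefixBit_lt _ _ _ (by omega), prefixBit_lt _ _ _ (by omega)]
      have : ¬ (2 * i) % 2 = 1 := by omega
      simp [twist]
    · rw [prefixBit_lt _ _ _ (by omega), prefixBit_lt _ _ _ (by omega),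
        prefixBit_lt _ _ _ (by omega)]
      have : (2 * i + 1) % 2 = 1 := by omega
      simp [twist, this]

/-- Adjacency in a crossed cube: within the two halves, or along the matching `twist`. -/
theorem crossedCube_adj_prefixBit {n : ℕ} (b c : Bool) (x y : Fin n → Bool) :
    (crossedCube (n + 1)).Adj (prefixBit b x) (prefixBit c y) ↔
      (b = c ∧ (crossedCube n).Adj x y) ∨ (b ≠ c ∧ y = twist x) := by
  cases n with
  | zero =>
    have h1 : x = y := Subsingleton.elim _ _
    have h2 : y = twist y := Subsingleton.elim _ _
    simp only [h1, crossedCube, SimpleGraph.top_adj, SimpleGraph.bot_adj, ne_eq, prefixBit_inj]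
    simp [← h2]
  | succ m =>
    change ((_ = _ ∧ _) ∨ (_ ≠ _ ∧ _)) ↔ _
    rw [prefixBit_last, prefixBit_last, init_prefixBit, init_prefixBit, crossRelated_prefixBit]

/-- A triangle crosses between the halves along none or two of its edges; two would share an end,
which a matching forbids. -/
theorem crossedCube_triangle_free {n : ℕ} {u v w : Fin n → Bool}
    (huv : (crossedCube n).Adj u v) (hvw : (crossedCube n).Adj v w)
    (huw : (crossedCube n).Adj u w) : False := by
  induction n with
  | zero => exact huv.ne (Subsingleton.elim _ _)
  | succ n ih =>
    obtain ⟨a, x, rfl⟩ := exists_prefixBit u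
    obtain ⟨b, y, rfl⟩ := exists_prefixBit v
    obtain ⟨c, z, rfl⟩ := exists_prefixBit w
    rw [crossedCube_adj_prefixBit] at huv hvw huw
    rcases huv with ⟨rfl, h1⟩ | ⟨hab, rfl⟩
    · rcases hvw with ⟨rfl, h2⟩ | ⟨hbc, rfl⟩
      · rcases huw with ⟨_, h3⟩ | ⟨h, _⟩
        · exact ih h1 h2 h3
        · exact h rfl
      · rcases huw with ⟨h, _⟩ | ⟨_, h⟩
        · exact hbc h
        · exact h1.ne (twist_injective h).symm
    · rcases hvw with ⟨rfl, h2⟩ | ⟨hbc, rfl⟩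
      · rcases huw with ⟨h, _⟩ | ⟨_, rfl⟩
        · exact hab h
        · exact h2.ne rfl
      · rcases huw with ⟨_, h⟩ | ⟨h, _⟩
        · exact h.ne (twist_twist x).symm
        · cases a <;> cases b <;> cases c <;> simp_all

theorem crossedCube_neighborSet_ncard {n : ℕ} (u : Fin n → Bool) :
    ((crossedCube n).neighborSet u).ncard = n := by
  induction n with
  | zero => simp [crossedCube]
  | succ n ih =>
    obtain ⟨b, x, rfl⟩ := exists_prefixBit u
    have : (crossedCube (n + 1)).neighborSet (prefixBit b x) =
        insert (prefixBit (!b) (twist x)) (prefixBit b '' (crossedCube n).neighborSet x) := by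
      ext w
      obtain ⟨c, z, rfl⟩ := exists_prefixBit w
      simp only [SimpleGraph.mem_neighborSet, crossedCube_adj_prefixBit, Set.mem_insert_iff,
        Set.mem_image, prefixBit_inj]
      cases b <;> cases c <;> simp
    rw [this, Set.ncard_insert_of_notMem, Set.ncard_image_of_injective _ (prefixBit_injective b),
      ih]
    rintro ⟨z, _, hz⟩
    have := (prefixBit_inj.1 hz).1
    cases b <;> simp at this

/-- Every crossed cube of dimension at least two contains a 4-cycle. -/
theorem crossedCube_exists_four_cycle (n : ℕ) : ∃ u v b a : Fin (n + 2) → Bool,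
    (crossedCube (n + 2)).Adj u v ∧ (crossedCube (n + 2)).Adj v b ∧
    (crossedCube (n + 2)).Adj b a ∧ (crossedCube (n + 2)).Adj a u ∧ u ≠ b ∧ v ≠ a := by
  induction n with
  | zero =>
    have h : (crossedCube 1).Adj (fun _ => false) (fun _ => true) := by
      simp only [crossedCube, SimpleGraph.top_adj]
      exact fun h => by simpa using congrFun h 0
    have ht (c : Bool) : twist (fun _ : Fin 1 => c) = fun _ => c := by
      funext j; simp [twist]
    refine ⟨prefixBit false (fun _ => false), prefixBit false (fun _ => true),
      prefixBit true (fun _ => true), prefixBit true (fun _ => false), ?_, ?_, ?_, ?_, ?_, ?_⟩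
    · rw [crossedCube_adj_prefixBit]; exact Or.inl ⟨rfl, h⟩
    · rw [crossedCube_adj_prefixBit]; exact Or.inr ⟨by simp, (ht _).symm⟩
    · rw [crossedCube_adj_prefixBit]; exact Or.inl ⟨rfl, h.symm⟩
    · rw [crossedCube_adj_prefixBit]; exact Or.inr ⟨by simp, (ht _).symm⟩
    · simp [prefixBit_inj]
    · simp [prefixBit_inj]
  | succ n ih =>
    obtain ⟨u, v, b, a, h1, h2, h3, h4, h5, h6⟩ := ih
    refine ⟨prefixBit false u, prefixBit false v, prefixBit false b, prefixBit false a,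
      ?_, ?_, ?_, ?_, ?_, ?_⟩ <;> simp_all [crossedCube_adj_prefixBit, prefixBit_inj]

/-! The vertices and edges of the BCDC network. -/

/-- Both sides obey the same recursion, two prefixed copies and the cross matching, and agree on the
4-cycle. -/
theorem bcdcVerts_eq_edgeSet (n : ℕ) :
    bcdcVerts (n + 2) = (crossedCube (n + 2)).edgeSet := by
  induction n with
  | zero =>
    ext e
    induction e with | _ u v
    rw [SimpleGraph.mem_edgeSet]
    -- `CQ_2` joins strings that differ in one bit; in this form the comparison with the four
    -- servers is decidable.
    have key : (crossedCube 2).Adj u v ↔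
        (u 1 = v 1 ∧ u 0 ≠ v 0) ∨ (u 1 ≠ v 1 ∧ u 0 = v 0) := by
      obtain ⟨b, x, rfl⟩ := exists_prefixBit u
      obtain ⟨c, y, rfl⟩ := exists_prefixBit v
      have hx (b : Bool) (x : Fin 1 → Bool) : prefixBit b x 0 = x 0 :=
        prefixBit_lt b x 0 (by omega)
      have hl (b : Bool) (x : Fin 1 → Bool) : prefixBit b x 1 = b := prefixBit_last b x
      rw [crossedCube_adj_prefixBit, hx, hx, hl, hl]
      have ht : twist x = x := by funext j; simp [twist]
      have he : ∀ x y : Fin 1 → Bool, x = y ↔ x 0 = y 0 := fun x y =>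
        ⟨fun h => by rw [h], fun h => funext fun j => by rwa [Subsingleton.elim j 0]⟩
      rw [ht, he y x]
      simp [crossedCube, he, eq_comm]
    refine Iff.trans ?_ key.symm
    simp only [bcdcVerts, Set.mem_insert_iff, Set.mem_singleton_iff]
    clear key
    revert u v
    decide
  | succ n ih =>
    ext e
    induction e with | _ u v
    obtain ⟨b, x, rfl⟩ := exists_prefixBit u
    obtain ⟨c, y, rfl⟩ := exists_prefixBit v
    have hpre (d : Bool) : s(prefixBit b x, prefixBit c y) ∈
        prefixServer d '' bcdcVerts (n + 2) ↔
        b = d ∧ c = d ∧ (crossedCube (n + 2)).Adj x y := by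
      rw [ih]
      constructor
      · rintro ⟨e, he, h⟩
        induction e with | _ p q
        simp only [prefixServer, Sym2.map_mk, Sym2.eq_iff, prefixBit_inj] at h
        rw [SimpleGraph.mem_edgeSet] at he
        rcases h with ⟨⟨rfl, rfl⟩, rfl, rfl⟩ | ⟨⟨rfl, rfl⟩, rfl, rfl⟩
        · exact ⟨rfl, rfl, he⟩
        · exact ⟨rfl, rfl, he.symm⟩
      · rintro ⟨rfl, rfl, h⟩
        exact ⟨s(x, y), h, by simp [prefixServer]⟩
    have hcross : s(prefixBit b x, prefixBit c y) ∈ crossServers (n + 2) ↔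
        b ≠ c ∧ y = twist x := by
      simp only [crossServers, Set.mem_ofPred_eq, crossedCube_adj_prefixBit]
      constructor
      · rintro ⟨p, q, h, he⟩
        simp only [Sym2.eq_iff, prefixBit_inj] at he
        rcases h with ⟨h, _⟩ | ⟨_, rfl⟩
        · simp at h
        · rcases he with ⟨⟨rfl, rfl⟩, rfl, rfl⟩ | ⟨⟨rfl, rfl⟩, rfl, rfl⟩
          · simp
          · simp [twist_twist]
      · rintro ⟨h, rfl⟩
        cases b <;> cases c
        · exact absurd rfl h
        · exact ⟨x, twist x, by simp, rfl⟩
        · exact ⟨twist x, x, by simp [twist_twist], Sym2.eq_swap⟩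
        · exact absurd rfl h
    change _ ∈ prefixServer false '' bcdcVerts (n + 2) ∪ prefixServer true '' bcdcVerts (n + 2) ∪
      crossServers (n + 2) ↔ _
    rw [SimpleGraph.mem_edgeSet, crossedCube_adj_prefixBit, Set.mem_union, Set.mem_union, hpre,
      hpre, hcross]
    cases b <;> cases c <;> simp

theorem mem_prefixServer {n : ℕ} {b : Bool} {e : Sym2 (Fin n → Bool)} {v : Fin (n + 1) → Bool} :
    v ∈ prefixServer b e ↔ ∃ x ∈ e, v = prefixBit b x := by
  simp [prefixServer, Sym2.mem_map, eq_comm]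

/-- Within a copy this is induction. A cross server meets a server of a copy only in its own end
there, and distinct cross servers are disjoint because they come from a matching. -/
theorem bcdcEdges_adj (n : ℕ) (e f : Sym2 (Fin (n + 2) → Bool)) :
    (bcdcEdges (n + 2)).Adj e f ↔
      e ∈ bcdcVerts (n + 2) ∧ f ∈ bcdcVerts (n + 2) ∧ e ≠ f ∧ ∃ v, v ∈ e ∧ v ∈ f := by
  induction n with
  | zero =>
    change (SimpleGraph.fromEdgeSet _).Adj e f ↔ _
    rw [SimpleGraph.fromEdgeSet_adj]
    simp only [bcdcVerts, Set.mem_insert_iff, Set.mem_singleton_iff]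
    constructor
    · rintro ⟨h, hne⟩
      simp only [Sym2.eq_iff (α := Sym2 _)] at h
      rcases h with (⟨rfl, rfl⟩ | ⟨rfl, rfl⟩) | (⟨rfl, rfl⟩ | ⟨rfl, rfl⟩) |
        (⟨rfl, rfl⟩ | ⟨rfl, rfl⟩) | (⟨rfl, rfl⟩ | ⟨rfl, rfl⟩) <;> decide
    · rintro ⟨he, hf, hne, v, hv, hv'⟩
      refine ⟨?_, hne⟩
      rcases he with rfl | rfl | rfl | rfl <;> rcases hf with rfl | rfl | rfl | rfl <;>
        first
        | exact absurd rfl hne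
        | decide
        | (exfalso; revert v; decide)
  | succ n ih =>
    change (SimpleGraph.fromRel _).Adj e f ↔ _
    rw [SimpleGraph.fromRel_adj]
    have hV : ∀ g, g ∈ bcdcVerts (n + 1 + 2) ↔
        (∃ b, g ∈ prefixServer b '' bcdcVerts (n + 2)) ∨ g ∈ crossServers (n + 2) := by
      intro g
      change g ∈ prefixServer false '' bcdcVerts (n + 2) ∪
        prefixServer true '' bcdcVerts (n + 2) ∪ crossServers (n + 2) ↔ _
      rw [Set.mem_union, Set.mem_union, Bool.exists_bool]
    constructor
    · rintro ⟨hne, h⟩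
      wlog hR : (∃ (b : Bool) (e' f' : Sym2 (Fin (n + 2) → Bool)),
          (bcdcEdges (n + 2)).Adj e' f' ∧ e = prefixServer b e' ∧ f = prefixServer b f') ∨
        (∃ x y : Fin (n + 2) → Bool,
          (crossedCube (n + 3)).Adj (prefixBit false x) (prefixBit true y) ∧
          f = s(prefixBit false x, prefixBit true y) ∧
          ((e ∈ prefixServer false '' bcdcVerts (n + 2) ∧ prefixBit false x ∈ e) ∨
           (e ∈ prefixServer true '' bcdcVerts (n + 2) ∧ prefixBit true y ∈ e))) generalizing e f
      · obtain ⟨h1, h2, h3, v, h4, h5⟩ :=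
          this f e hne.symm h.symm (h.resolve_left hR)
        exact ⟨h2, h1, h3.symm, v, h5, h4⟩
      rcases hR with ⟨b, e', f', hadj, rfl, rfl⟩ | ⟨x, y, hadj, rfl, hR⟩
      · obtain ⟨h1, h2, h3, v, h4, h5⟩ := (ih e' f').1 hadj
        exact ⟨(hV _).2 (Or.inl ⟨b, _, h1, rfl⟩), (hV _).2 (Or.inl ⟨b, _, h2, rfl⟩), hne,
          prefixBit b v, mem_prefixServer.2 ⟨v, h4, rfl⟩, mem_prefixServer.2 ⟨v, h5, rfl⟩⟩
      · have hf : s(prefixBit false x, prefixBit true y) ∈ bcdcVerts (n + 1 + 2) :=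
          (hV _).2 (Or.inr ⟨x, y, hadj, rfl⟩)
        rcases hR with ⟨h1, h2⟩ | ⟨h1, h2⟩
        · exact ⟨(hV _).2 (Or.inl ⟨_, h1⟩), hf, hne, _, h2, Sym2.mem_mk_left _ _⟩
        · exact ⟨(hV _).2 (Or.inl ⟨_, h1⟩), hf, hne, _, h2, Sym2.mem_mk_right _ _⟩
    · rintro ⟨he, hf, hne, v, hve, hvf⟩
      refine ⟨hne, ?_⟩
      have hmix (e f : Sym2 (Fin (n + 3) → Bool)) (hve : v ∈ e) (hvf : v ∈ f)
          (he : ∃ b, e ∈ prefixServer b '' bcdcVerts (n + 2))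
          (hf : f ∈ crossServers (n + 2)) : ∃ x y : Fin (n + 2) → Bool,
            (crossedCube (n + 3)).Adj (prefixBit false x) (prefixBit true y) ∧
            f = s(prefixBit false x, prefixBit true y) ∧
            ((e ∈ prefixServer false '' bcdcVerts (n + 2) ∧ prefixBit false x ∈ e) ∨
             (e ∈ prefixServer true '' bcdcVerts (n + 2) ∧ prefixBit true y ∈ e)) := by
        obtain ⟨x, y, hadj, rfl⟩ := hf
        obtain ⟨b, he⟩ := he
        refine ⟨x, y, hadj, rfl, ?_⟩
        have hb : ∃ z, v = prefixBit b z := by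
          obtain ⟨e', _, rfl⟩ := he
          obtain ⟨z, _, hz⟩ := mem_prefixServer.1 hve
          exact ⟨z, hz⟩
        obtain ⟨z, rfl⟩ := hb
        rcases Sym2.mem_iff.1 hvf with h | h
        · obtain ⟨rfl, rfl⟩ := prefixBit_inj.1 h
          exact Or.inl ⟨he, hve⟩
        · obtain ⟨rfl, rfl⟩ := prefixBit_inj.1 h
          exact Or.inr ⟨he, hve⟩
      rcases (hV e).1 he with he' | he' <;> rcases (hV f).1 hf with hf' | hf'
      · obtain ⟨b, e', he', rfl⟩ := he'
        obtain ⟨c, f', hf', rfl⟩ := hf'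
        obtain ⟨x, hx, rfl⟩ := mem_prefixServer.1 hve
        obtain ⟨y, hy, hxy⟩ := mem_prefixServer.1 hvf
        obtain ⟨rfl, rfl⟩ := prefixBit_inj.1 hxy
        exact Or.inl (Or.inl ⟨b, e', f', (ih e' f').2 ⟨he', hf', fun h => hne (by rw [h]),
          x, hx, hy⟩, rfl, rfl⟩)
      · exact Or.inl (Or.inr (hmix e f hve hvf he' hf'))
      · exact Or.inr (Or.inr (hmix f e hvf hve hf' he'))
      · exfalso
        obtain ⟨x, y, h, rfl⟩ := he'
        obtain ⟨x', y', h', rfl⟩ := hf'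
        simp only [crossedCube_adj_prefixBit, Bool.false_eq_true, false_and, false_or,
          ne_eq, not_false_eq_true, true_and] at h h'
        subst h h'
        apply hne
        rcases Sym2.mem_iff.1 hve with rfl | rfl <;> rcases Sym2.mem_iff.1 hvf with h | h <;>
          obtain ⟨h0, h⟩ := prefixBit_inj.1 h
        · rw [h]
        · cases h0
        · cases h0
        · rw [twist_injective h]

/-! Edge boundaries. -/

section Boundary

variable {V : Type*} [Fintype V] {G : SimpleGraph V}

open Classical in
/-- The edges of `G` that leave `S`, as ordered pairs. -/
noncomputable def edgeBoundary (G : SimpleGraph V) (S : Finset V) : Finset (V × V) :=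
  Finset.univ.filter fun p => G.Adj p.1 p.2 ∧ p.1 ∈ S ∧ p.2 ∉ S

theorem mem_edgeBoundary {S : Finset V} {p : V × V} :
    p ∈ edgeBoundary G S ↔ G.Adj p.1 p.2 ∧ p.1 ∈ S ∧ p.2 ∉ S := by
  simp [edgeBoundary]

theorem card_edgeBoundary_compl [DecidableEq V] (S : Finset V) :
    (edgeBoundary G Sᶜ).card = (edgeBoundary G S).card := by
  refine Finset.card_bij (fun p _ => p.swap) ?_ ?_ ?_
  · intro p hp
    simp only [mem_edgeBoundary, Finset.mem_compl, not_not] at hp ⊢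
    exact ⟨hp.1.symm, hp.2.2, hp.2.1⟩
  · intro p _ q _ h
    exact Prod.swap_injective h
  · intro p hp
    refine ⟨p.swap, ?_, p.swap_swap⟩
    simp only [mem_edgeBoundary, Finset.mem_compl, not_not] at hp ⊢
    exact ⟨hp.1.symm, hp.2.2, hp.2.1⟩

open Classical in
theorem card_edgeBoundary_eq_sum (S : Finset V) :
    (edgeBoundary G S).card =
      ∑ v ∈ S, (Finset.univ.filter fun w => G.Adj v w ∧ w ∉ S).card := by
  rw [← Finset.card_sigma]
  refine Finset.card_bij (fun p _ => ⟨p.1, p.2⟩) ?_ ?_ ?_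
  · intro p hp
    simpa [mem_edgeBoundary, and_left_comm] using hp
  · rintro ⟨a, b⟩ _ ⟨c, d⟩ _ h
    simpa using h
  · rintro ⟨a, b⟩ h
    exact ⟨(a, b), by simpa [mem_edgeBoundary, and_left_comm] using h, rfl⟩

open Classical in
theorem card_filter_adj_add {n : ℕ} (hreg : ∀ v, (G.neighborSet v).ncard = n)
    (S : Finset V) (v : V) :
    (Finset.univ.filter fun w => G.Adj v w ∧ w ∉ S).card +
      (S.filter fun w => G.Adj v w).card = n := by
  rw [← hreg v, Set.ncard_eq_toFinset_card', ← Finset.card_union_of_disjoint]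
  · congr 1
    ext w
    by_cases h : w ∈ S <;> simp [h]
  · rw [Finset.disjoint_left]
    intro w h1 h2
    simp only [Finset.mem_filter] at h1 h2
    exact h1.2.2 h2.1

open Classical in
/-- A small set of vertices of a triangle-free regular graph that spans an edge has a large
edge boundary. -/
theorem le_card_edgeBoundary_of_adj {n : ℕ} (hreg : ∀ v, (G.neighborSet v).ncard = n)
    (htri : ∀ u v w, G.Adj u v → G.Adj v w → G.Adj u w → False)
    {S : Finset V} {u v : V} (huv : G.Adj u v) (hu : u ∈ S) (hv : v ∈ S) :
    2 * n + (S.card - 2) * (n + 2 - S.card) ≤ (edgeBoundary G S).card + S.card := by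
  rw [card_edgeBoundary_eq_sum]
  have hv' : v ∈ S.erase u := Finset.mem_erase.2 ⟨huv.ne', hv⟩
  have hcard : ((S.erase u).erase v).card = S.card - 2 := by
    rw [Finset.card_erase_of_mem hv', Finset.card_erase_of_mem hu]; omega
  have h2 : 2 ≤ S.card := by
    have := Finset.card_pos.2 ⟨v, hv'⟩
    rw [Finset.card_erase_of_mem hu] at this; omega
  rw [← Finset.add_sum_erase S _ hu, ← Finset.add_sum_erase (S.erase u) _ hv']
  -- Without triangles, `u` and `v` have disjoint neighbourhoods inside `S`.
  have huv_deg : (S.filter fun w => G.Adj u w).card + (S.filter fun w => G.Adj v w).card ≤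
      S.card := by
    rw [← Finset.card_union_of_disjoint]
    · exact Finset.card_le_card (Finset.union_subset (Finset.filter_subset _ _)
        (Finset.filter_subset _ _))
    · rw [Finset.disjoint_left]
      intro w h1 h2
      exact htri u v w huv (Finset.mem_filter.1 h2).2 (Finset.mem_filter.1 h1).2
  have hrest : (S.card - 2) * (n + 2 - S.card) ≤ ∑ w ∈ (S.erase u).erase v,
      (Finset.univ.filter fun x => G.Adj w x ∧ x ∉ S).card := by
    rw [← hcard, ← smul_eq_mul]
    refine Finset.card_nsmul_le_sum _ _ _ fun w hw => ?_
    have hwS : w ∈ S := Finset.mem_of_mem_erase (Finset.mem_of_mem_erase hw)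
    have hle : (S.filter fun x => G.Adj w x).card ≤ S.card - 2 := by
      -- Besides itself, `w` misses one of `u`, `v`, so it has at most `|S| - 2` neighbours in `S`.
      have hex : ∃ z ∈ S, z ≠ w ∧ ¬ G.Adj w z := by
        by_cases h : G.Adj w u
        · exact ⟨v, hv, (Finset.mem_erase.1 hw).1.symm, fun h' => htri w u v h huv h'⟩
        · exact ⟨u, hu, (Finset.mem_erase.1 (Finset.mem_erase.1 hw).2).1.symm, h⟩
      obtain ⟨z, hz, hzw, hnadj⟩ := hex
      have hsub : (S.filter fun x => G.Adj w x) ⊆ (S.erase w).erase z := by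
        intro x hx
        obtain ⟨h1, h2⟩ := Finset.mem_filter.1 hx
        exact Finset.mem_erase.2 ⟨fun h => hnadj (h ▸ h2), Finset.mem_erase.2 ⟨h2.ne', h1⟩⟩
      have := Finset.card_le_card hsub
      rw [Finset.card_erase_of_mem (Finset.mem_erase.2 ⟨hzw, hz⟩),
        Finset.card_erase_of_mem hwS] at this
      omega
    have := card_filter_adj_add hreg S w
    omega
  have h3 := card_filter_adj_add hreg S u
  have h4 := card_filter_adj_add hreg S v
  omega

theorem card_edgeBoundary_of_not_adj {n : ℕ} (hreg : ∀ v, (G.neighborSet v).ncard = n)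
    {S : Finset V} (h : ∀ u ∈ S, ∀ v ∈ S, ¬ G.Adj u v) :
    (edgeBoundary G S).card = S.card * n := by
  classical
  rw [card_edgeBoundary_eq_sum, Finset.sum_const_nat]
  intro v hv
  have h1 := card_filter_adj_add hreg S v
  have h2 : (S.filter fun w => G.Adj v w) = ∅ :=
    Finset.filter_eq_empty_iff.2 fun w hw => h v hv w hw
  rw [h2] at h1
  simpa using h1

end Boundary

/-! ### Edge isoperimetry in crossed cubes. -/

/-- The strings `x` for which `bx` is in `S`. -/
def halfOf {n : ℕ} (b : Bool) (S : Finset (Fin (n + 1) → Bool)) : Finset (Fin n → Bool) :=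
  Finset.univ.filter fun x => prefixBit b x ∈ S

theorem mem_halfOf {n : ℕ} {b : Bool} {S : Finset (Fin (n + 1) → Bool)} {x : Fin n → Bool} :
    x ∈ halfOf b S ↔ prefixBit b x ∈ S := by simp [halfOf]

theorem card_halfOf_add {n : ℕ} (b : Bool) (S : Finset (Fin (n + 1) → Bool)) :
    (halfOf b S).card + (halfOf (!b) S).card = S.card := by
  rw [← Finset.card_image_of_injective _ (prefixBit_injective b),
    ← Finset.card_image_of_injective (halfOf (!b) S) (prefixBit_injective (!b)),
    ← Finset.card_union_of_disjoint]
  · congr 1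
    ext u
    obtain ⟨c, x, rfl⟩ := exists_prefixBit u
    cases b <;> cases c <;> simp [mem_halfOf, prefixBit_inj]
  · rw [Finset.disjoint_left]
    intro u h1 h2
    obtain ⟨x, _, rfl⟩ := Finset.mem_image.1 h1
    obtain ⟨y, _, h⟩ := Finset.mem_image.1 h2
    have := (prefixBit_inj.1 h).1
    cases b <;> simp at this

/-- The boundary of `S` contains the boundaries within both halves and the cross edges that leave
`S` from half `b`. Since `twist` is injective, there are at least as many of the latter as half `b`
exceeds the other half. Stated additively to avoid truncated subtraction. -/
theorem card_edgeBoundary_halfOf {n : ℕ} (b : Bool) (S : Finset (Fin (n + 1) → Bool)) :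
    (edgeBoundary (crossedCube n) (halfOf b S)).card +
      (edgeBoundary (crossedCube n) (halfOf (!b) S)).card + (halfOf b S).card ≤
    (edgeBoundary (crossedCube (n + 1)) S).card + (halfOf (!b) S).card := by
  classical
  set D := (halfOf b S).filter fun x => twist x ∉ halfOf (!b) S with hD
  have h1 : (halfOf b S).card ≤ D.card + (halfOf (!b) S).card := by
    rw [← Finset.card_filter_add_card_filter_not (s := halfOf b S)
      (fun x => twist x ∉ halfOf (!b) S)]
    refine Nat.add_le_add_left ?_ _
    refine Finset.card_le_card_of_injOn twist ?_ twist_injective.injOn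
    intro x hx
    simpa using (Finset.mem_filter.1 hx).2
  have hb : b ≠ !b := by cases b <;> simp
  set e : Bool → (Fin n → Bool) × (Fin n → Bool) →
      (Fin (n + 1) → Bool) × (Fin (n + 1) → Bool) :=
    fun c p => (prefixBit c p.1, prefixBit c p.2) with he
  have hinj (c) : Function.Injective (e c) := by
    rintro ⟨p, q⟩ ⟨p', q'⟩ h
    simpa [he, prefixBit_inj] using h
  set d : (Fin n → Bool) → (Fin (n + 1) → Bool) × (Fin (n + 1) → Bool) :=
    fun x => (prefixBit b x, prefixBit (!b) (twist x)) with hd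
  have hdinj : Function.Injective d := by
    intro x y h
    exact (prefixBit_inj.1 (Prod.ext_iff.1 h).1).2
  have hle : ((edgeBoundary (crossedCube n) (halfOf b S)).image (e b) ∪
      (edgeBoundary (crossedCube n) (halfOf (!b) S)).image (e (!b)) ∪ D.image d).card ≤
      (edgeBoundary (crossedCube (n + 1)) S).card := by
    refine Finset.card_le_card (Finset.union_subset (Finset.union_subset ?_ ?_) ?_)
    · intro p hp
      obtain ⟨⟨x, y⟩, hq, rfl⟩ := Finset.mem_image.1 hp
      simp only [mem_edgeBoundary, mem_halfOf, he] at hq ⊢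
      exact ⟨(crossedCube_adj_prefixBit _ _ _ _).2 (Or.inl ⟨rfl, hq.1⟩), hq.2⟩
    · intro p hp
      obtain ⟨⟨x, y⟩, hq, rfl⟩ := Finset.mem_image.1 hp
      simp only [mem_edgeBoundary, mem_halfOf, he] at hq ⊢
      exact ⟨(crossedCube_adj_prefixBit _ _ _ _).2 (Or.inl ⟨rfl, hq.1⟩), hq.2⟩
    · intro p hp
      obtain ⟨x, hx, rfl⟩ := Finset.mem_image.1 hp
      simp only [hD, Finset.mem_filter, mem_halfOf] at hx
      simp only [mem_edgeBoundary, hd]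
      exact ⟨(crossedCube_adj_prefixBit _ _ _ _).2 (Or.inr ⟨hb, rfl⟩), hx⟩
  rw [Finset.card_union_of_disjoint, Finset.card_union_of_disjoint,
    Finset.card_image_of_injective _ (hinj _), Finset.card_image_of_injective _ (hinj _),
    Finset.card_image_of_injective _ hdinj] at hle
  · omega
  · rw [Finset.disjoint_left]
    intro p h1 h2
    obtain ⟨x, _, rfl⟩ := Finset.mem_image.1 h1
    obtain ⟨y, _, h⟩ := Finset.mem_image.1 h2
    exact hb (prefixBit_inj.1 (Prod.ext_iff.1 h).1).1.symm
  · rw [Finset.disjoint_left]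
    intro p h1 h2
    obtain ⟨y, _, rfl⟩ := Finset.mem_image.1 h2
    rcases Finset.mem_union.1 h1 with h1 | h1 <;> obtain ⟨x, _, h⟩ := Finset.mem_image.1 h1
    · exact hb (prefixBit_inj.1 (Prod.ext_iff.1 h).2).1
    · exact hb (prefixBit_inj.1 (Prod.ext_iff.1 h).1).1.symm

/-- An edge-isoperimetric inequality for crossed cubes. -/
theorem crossedCube_isoperimetric (n : ℕ) (S : Finset (Fin (n + 1) → Bool)) :
    2 * S.card ≤ (edgeBoundary (crossedCube (n + 1)) S).card ∨
    2 ^ n ≤ (edgeBoundary (crossedCube (n + 1)) S).card ∨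
    2 ^ (n + 2) ≤ (edgeBoundary (crossedCube (n + 1)) S).card + 2 * S.card := by
  induction n with
  | zero =>
    by_cases h0 : S = ∅
    · simp [h0]
    by_cases h1 : S = Finset.univ
    · right; right; simp [h1]
    right; left
    obtain ⟨x, hx⟩ := Finset.nonempty_iff_ne_empty.2 h0
    obtain ⟨y, hy⟩ : ∃ y, y ∉ S := by
      by_contra! h
      exact h1 (Finset.eq_univ_iff_forall.2 h)
    refine Finset.card_pos.2 ⟨(x, y), mem_edgeBoundary.2 ⟨?_, hx, hy⟩⟩
    simp only [crossedCube, SimpleGraph.top_adj]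
    exact fun h => hy (h ▸ hx)
  | succ n ih =>
    have h0 := ih (halfOf false S)
    have h1 := ih (halfOf true S)
    have h2 := card_edgeBoundary_halfOf false S
    have h3 := card_edgeBoundary_halfOf true S
    have h4 := card_halfOf_add false S
    simp only [Bool.not_true, Bool.not_false] at h2 h3 h4
    have e1 : 2 ^ (n + 1) = 2 * 2 ^ n := by ring
    have e2 : 2 ^ (n + 2) = 4 * 2 ^ n := by ring
    have e3 : 2 ^ (n + 1 + 2) = 8 * 2 ^ n := by ring
    rw [e2] at h0 h1
    rw [e1, e3]
    -- The claim bounds the boundary below by the least of `2|S|`, half the number of vertices and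
    -- `2|Sᶜ|`. The boundary of `S` is at least the sum of those of the halves plus the difference
    -- of their sizes, so each of the nine cases is linear in `N`.
    generalize 2 ^ n = N at *
    omega

theorem crossedCube_card_vertices (n : ℕ) : Fintype.card (Fin n → Bool) = 2 ^ n := by simp

/-- Edge sets whose removal leaves no small component other than single vertices are large:
the edge boundary of a set of between `2` and `2 ^ n - 2` vertices has at least `2 n - 2` edges,
with equality only for the two ends of an edge and for their complements. -/
theorem crossedCube_edgeBoundary {n : ℕ} (hn : 4 ≤ n) (S : Finset (Fin n → Bool))
    (h2 : 2 ≤ S.card) (h2' : 2 ≤ Sᶜ.card) :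
    2 * n - 1 ≤ (edgeBoundary (crossedCube n) S).card ∨
    ((edgeBoundary (crossedCube n) S).card = 2 * n - 2 ∧
      ∃ u v, (crossedCube n).Adj u v ∧ (S = {u, v} ∨ Sᶜ = {u, v})) := by
  have hsum : S.card + Sᶜ.card = 2 ^ n := by
    rw [Finset.card_add_card_compl, crossedCube_card_vertices]
  wlog hle : S.card ≤ Sᶜ.card generalizing S
  · have := this Sᶜ h2' (by rwa [compl_compl]) (by rw [compl_compl]; omega)
      (by rw [compl_compl]; omega)
    rw [card_edgeBoundary_compl, compl_compl] at this
    obtain h | ⟨h, u, v, h', h''⟩ := this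
    · exact Or.inl h
    · exact Or.inr ⟨h, u, v, h', h''.symm⟩
  -- From `n` vertices on, isoperimetry gives at least `2n` boundary edges; below that, degrees are
  -- counted.
  by_cases hs : n ≤ S.card
  · left
    obtain ⟨m, rfl⟩ : ∃ m, n = m + 1 := ⟨n - 1, by omega⟩
    have hpow : 2 * (m + 1) ≤ 2 ^ m := by
      clear * - hn
      obtain ⟨k, rfl⟩ : ∃ k, m = k + 3 := ⟨m - 3, by omega⟩
      clear hn
      induction k with
      | zero => norm_num
      | succ k ih => rw [show k + 1 + 3 = (k + 3) + 1 by ring, pow_succ]; omega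
    have := crossedCube_isoperimetric m S
    have e1 : 2 ^ (m + 2) = 4 * 2 ^ m := by ring
    have e2 : 2 ^ (m + 1) = 2 * 2 ^ m := by ring
    omega
  · by_cases hadj : ∃ u ∈ S, ∃ v ∈ S, (crossedCube n).Adj u v
    · obtain ⟨u, hu, v, hv, huv⟩ := hadj
      have h := le_card_edgeBoundary_of_adj crossedCube_neighborSet_ncard
        (fun _ _ _ => crossedCube_triangle_free) huv hu hv
      by_cases h3 : S.card = 2
      · have hS : S = {u, v} := by
          symm
          apply Finset.eq_of_subset_of_card_le
          · intro x hx
            rcases Finset.mem_insert.1 hx with rfl | hx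
            · exact hu
            · rwa [Finset.mem_singleton.1 hx]
          · rw [h3, Finset.card_pair huv.ne]
        rw [h3] at h
        simp only [Nat.sub_self, zero_mul] at h
        rcases Nat.lt_or_ge (2 * n - 2) (edgeBoundary (crossedCube n) S).card with h' | h'
        · left; omega
        · exact Or.inr ⟨by omega, u, v, huv, Or.inl hS⟩
      · left
        -- With `b = n - a - 4`, the degree count exceeds `2n` by at least `(a + 1)(b + 3) - (a + 3)
        -- = ab + 2a + b ≥ 0`.
        obtain ⟨a, ha⟩ : ∃ a, S.card = a + 3 := ⟨S.card - 3, by omega⟩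
        obtain ⟨b, hb⟩ : ∃ b, n = a + 3 + 1 + b := ⟨n - (a + 3 + 1), by omega⟩
        rw [ha, show a + 3 - 2 = a + 1 by omega, show n + 2 - (a + 3) = b + 3 by omega] at h
        nlinarith [Nat.sub_le (2 * n) 1]
    · left
      push Not at hadj
      rw [card_edgeBoundary_of_not_adj crossedCube_neighborSet_ncard hadj]
      calc 2 * n - 1 ≤ 2 * n := Nat.sub_le _ _
        _ ≤ _ := Nat.mul_le_mul_right _ h2

/-! Vertex cuts of line graphs. -/

section LineGraph

variable {V : Type*} {G : SimpleGraph V}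

/-- A vertex cut of the line graph of `G` contains the edge boundary of a set of vertices of `G`
with at least two vertices inside and outside. -/
theorem exists_edgeBoundary_subset_of_not_preconnected [Fintype V] [DecidableEq V] {C : Set G.edgeSet}
    (hC : ¬ (G.lineGraph.induce Cᶜ).Preconnected) :
    ∃ S : Finset V, 2 ≤ S.card ∧ 2 ≤ Sᶜ.card ∧
      ∀ p ∈ edgeBoundary G S, ∃ e ∈ C, (e : Sym2 V) = s(p.1, p.2) := by
  classical
  simp only [SimpleGraph.Preconnected, not_forall] at hC
  obtain ⟨e, f, hef⟩ := hC
  -- `S` consists of the ends of all edges that `e` reaches outside `C`. It contains the ends of `e`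
  -- and misses those of `f`; a boundary edge outside `C` would itself be reached.
  set R := (G.lineGraph.induce Cᶜ).Reachable e with hR
  set S : Finset V := Finset.univ.filter fun x => ∃ g, R g ∧ x ∈ (g.1.1 : Sym2 V) with hS
  have hext : ∀ g h : (Cᶜ : Set G.edgeSet), R g → (∃ x, x ∈ g.1.1 ∧ x ∈ h.1.1) → R h := by
    intro g h hg hx
    by_cases hgh : g = h
    · exact hgh ▸ hg
    · refine hg.trans (SimpleGraph.Adj.reachable ?_)
      rw [SimpleGraph.comap_adj]
      exact SimpleGraph.lineGraph_adj_iff_exists.2 ⟨fun h' => hgh (Subtype.ext h'), hx⟩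
  have hmem : ∀ x, x ∈ S ↔ ∃ g, R g ∧ x ∈ (g.1.1 : Sym2 V) := by simp [hS]
  have htwo : ∀ (T : Finset V) (g : (Cᶜ : Set G.edgeSet)),
      (∀ x ∈ (g.1.1 : Sym2 V), x ∈ T) → 2 ≤ T.card := by
    rintro T ⟨⟨g, hg⟩, _⟩ h
    induction g with | _ a b
    rw [← Finset.card_pair (G.ne_of_adj hg)]
    refine Finset.card_le_card ?_
    intro x hx
    refine h x ?_
    simpa using hx
  refine ⟨S, htwo S e fun x hx => (hmem x).2 ⟨e, SimpleGraph.Reachable.refl e, hx⟩,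
    htwo Sᶜ f fun x hx => ?_, ?_⟩
  · rw [Finset.mem_compl, hmem]
    rintro ⟨g, hg, hxg⟩
    exact hef (hext g f hg ⟨x, hxg, hx⟩)
  · rintro ⟨a, b⟩ hp
    obtain ⟨hab, ha, hb⟩ := mem_edgeBoundary.1 hp
    refine ⟨⟨s(a, b), hab⟩, ?_, rfl⟩
    by_contra hnot
    obtain ⟨g, hg, hag⟩ := (hmem a).1 ha
    exact hb ((hmem b).2 ⟨⟨⟨s(a, b), hab⟩, hnot⟩,
      hext g _ hg ⟨a, hag, Sym2.mem_mk_left a b⟩, Sym2.mem_mk_right a b⟩)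

/-- Ordered pairs do not count an edge twice: only one orientation starts in `S`. -/
theorem card_edgeBoundary_le_ncard [Fintype V] {C : Set G.edgeSet} {S : Finset V}
    (h : ∀ p ∈ edgeBoundary G S, ∃ e ∈ C, (e : Sym2 V) = s(p.1, p.2)) :
    (edgeBoundary G S).card ≤ C.ncard := by
  classical
  rw [← Set.ncard_coe_finset, ← Set.ncard_image_of_injective C Subtype.val_injective]
  refine Set.ncard_le_ncard_of_injOn (fun p => s(p.1, p.2)) (fun p hp => ?_) ?_ (Set.toFinite _)
  · obtain ⟨e, he, hep⟩ := h p hp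
    exact ⟨e, he, hep⟩
  · intro p hp q hq hpq
    rcases Sym2.eq_iff.1 hpq with ⟨h1, h2⟩ | ⟨h1, h2⟩
    · exact Prod.ext h1 h2
    · exact absurd (h2 ▸ (mem_edgeBoundary.1 hq).2.1) (mem_edgeBoundary.1 hp).2.2

/-- The edges of `G` at `u` other than `uv`. -/
def edgesAtExcept (G : SimpleGraph V) (u v : V) : Set G.edgeSet :=
  {e | u ∈ (e : Sym2 V) ∧ v ∉ (e : Sym2 V)}

theorem mem_edgesAtExcept {u v : V} {e : G.edgeSet} :
    e ∈ edgesAtExcept G u v ↔ u ∈ (e : Sym2 V) ∧ v ∉ (e : Sym2 V) := Iff.rfl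

theorem ncard_edgesAtExcept {n : ℕ} (hreg : ∀ v, (G.neighborSet v).ncard = n) {u v : V}
    (huv : G.Adj u v) : (edgesAtExcept G u v).ncard = n - 1 := by
  rw [← hreg u, ← Set.ncard_sdiff_singleton_of_mem (show v ∈ G.neighborSet u from huv)]
  symm
  refine Set.ncard_congr (fun x hx => ⟨s(u, x), hx.1⟩) ?_ ?_ ?_
  · rintro x ⟨hx, hxv⟩
    refine mem_edgesAtExcept.2 ⟨Sym2.mem_mk_left _ _, ?_⟩
    rw [Sym2.mem_iff]
    rintro (h | h)
    · exact huv.ne h.symm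
    · exact hxv h.symm
  · intro x y _ _ h
    exact Sym2.congr_right.1 (Subtype.ext_iff.1 h)
  · rintro ⟨e, he⟩ h
    obtain ⟨h1, h2⟩ := mem_edgesAtExcept.1 h
    obtain ⟨x, rfl⟩ := h1
    exact ⟨x, ⟨he, fun h' => h2 (Set.mem_singleton_iff.1 h' ▸ Sym2.mem_mk_right u x)⟩,
      rfl⟩

/-- A common end of the two edges would complete a triangle on `uv`. -/
theorem not_adj_edgesAtExcept
    (htri : ∀ u v w, G.Adj u v → G.Adj v w → G.Adj u w → False) {u v : V} (huv : G.Adj u v)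
    {e f : G.edgeSet} (he : e ∈ edgesAtExcept G u v) (hf : f ∈ edgesAtExcept G v u) :
    ¬ G.lineGraph.Adj e f := by
  rw [SimpleGraph.lineGraph_adj_iff_exists]
  rintro ⟨_, x, hxe, hxf⟩
  obtain ⟨e, heG⟩ := e
  obtain ⟨f, hfG⟩ := f
  obtain ⟨⟨a, rfl⟩, hve⟩ := he
  obtain ⟨⟨b, rfl⟩, huf⟩ := hf
  rcases Sym2.mem_iff.1 hxe with rfl | rfl
  · exact huf hxf
  · rcases Sym2.mem_iff.1 hxf with rfl | rfl
    · exact hve hxe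
    · exact htri u v _ huv hfG heG

end LineGraph

/-! ### The lower bound for substructure cuts. -/

theorem ncard_le_card_mul_of_subset_biUnion {W : Type*} [Finite W] {B : SimpleGraph W}
    {k : ℕ} (T : Finset B.Subgraph) (hT : ∀ K ∈ T, K.verts.ncard ≤ k) {A : Set W}
    (hA : ∀ x ∈ A, ∃ K ∈ T, x ∈ K.verts) : A.ncard ≤ T.card * k := by
  classical
  have := Fintype.ofFinite W
  calc A.ncard ≤ ((T.biUnion fun K => K.verts.toFinset : Finset W) : Set W).ncard := by
        refine Set.ncard_le_ncard (fun x hx => ?_) (Set.toFinite _)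
        obtain ⟨K, hK, hxK⟩ := hA x hx
        simpa using ⟨K, hK, hxK⟩
    _ = (T.biUnion fun K => K.verts.toFinset).card := Set.ncard_coe_finset _
    _ ≤ T.card * k := Finset.card_biUnion_le_card_mul _ _ _ fun K hK => by
        rw [← Set.ncard_eq_toFinset_card']; exact hT K hK

/-- A walk in `K` that starts in `A` can never step into `A'`. -/
theorem subset_of_preconnected {W : Type*} {B : SimpleGraph W} {K : B.Subgraph}
    (hK : K.coe.Preconnected) {A A' : Set W} (hAA : ∀ x ∈ A, ∀ y ∈ A', ¬ B.Adj x y)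
    (hsub : K.verts ⊆ A ∪ A') : K.verts ⊆ A ∨ K.verts ⊆ A' := by
  by_cases h : ∃ x : K.verts, (x : W) ∈ A
  · left
    obtain ⟨x, hx⟩ := h
    intro y hy
    obtain ⟨p⟩ := hK x ⟨y, hy⟩
    suffices ∀ (a b : K.verts), K.coe.Walk a b → (a : W) ∈ A → (b : W) ∈ A from
      this x ⟨y, hy⟩ p hx
    intro a b q
    induction q with
    | nil => exact id
    | cons hadj _ ih =>
      rename_i b' _ _
      intro ha
      refine ih ((hsub b'.2).resolve_right fun h' => hAA _ ha _ h' ?_)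
      exact K.adj_sub hadj
  · right
    intro y hy
    exact (hsub hy).resolve_left fun h' => h ⟨⟨y, hy⟩, h'⟩

/-- Excludes small cuts that leave one vertex, and in the upper bound provides a vertex from which
the isolated one is separated. -/
theorem crossedCube_edgeSet_ncard {n : ℕ} (hn : 4 ≤ n) :
    2 * n < Nat.card (crossedCube n).edgeSet := by
  classical
  have h := (crossedCube n).sum_degrees_eq_twice_card_edges
  have hdeg : ∀ v, (crossedCube n).degree v = n := fun v => by
    rw [← SimpleGraph.card_neighborSet_eq_degree, ← Nat.card_eq_fintype_card,
      Nat.card_coe_set_eq, crossedCube_neighborSet_ncard]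
  rw [Finset.sum_congr rfl fun v _ => hdeg v, Finset.sum_const, Finset.card_univ,
    crossedCube_card_vertices, smul_eq_mul] at h
  rw [Nat.card_eq_fintype_card, ← SimpleGraph.edgeFinset_card]
  have : 2 ^ 4 ≤ 2 ^ n := Nat.pow_le_pow_right (by norm_num) hn
  nlinarith

/-- The size of a substructure cut of the line graph of a crossed cube by paths. -/
theorem le_ncard_mul_of_isSubstructureCut {n k : ℕ} (hn : 4 ≤ n)
    {F : Set (crossedCube n).lineGraph.Subgraph}
    (hF : IsSubstructureCut (crossedCube n).lineGraph (SimpleGraph.pathGraph k) F)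
    (hfin : F.Finite) :
    2 * n - 1 ≤ F.ncard * k ∨ (F.ncard * k = 2 * n - 2 ∧ k ∣ n - 1) := by
  classical
  lift F to Finset (crossedCube n).lineGraph.Subgraph using hfin
  rw [Set.ncard_coe_finset]
  obtain ⟨hcut, hmem⟩ := hF
  have hcard : ∀ K ∈ F, K.verts.ncard ≤ k := by
    intro K hK
    obtain ⟨L, _, ⟨φ⟩⟩ := hmem K hK
    rw [← Nat.card_coe_set_eq, Nat.card_congr φ.toEquiv]
    calc Nat.card L.verts ≤ Nat.card (Fin k) := Nat.card_le_card_of_injective _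
          Subtype.val_injective
      _ = k := by simp
  have hconn : ∀ K ∈ F, K.coe.Preconnected := by
    intro K hK
    obtain ⟨L, hL, ⟨φ⟩⟩ := hmem K hK
    exact φ.preconnected_iff.2 hL.coe.preconnected
  by_contra! hcon
  obtain ⟨hlt, hdvd⟩ := hcon
  set C := coveredVerts (F : Set (crossedCube n).lineGraph.Subgraph) with hCdef
  have hCle : C.ncard ≤ F.card * k :=
    ncard_le_card_mul_of_subset_biUnion F hcard fun x hx => hx
  rw [IsSubgraphCut, ← hCdef] at hcut
  rcases hcut with hcut | ⟨w, hw⟩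
  · obtain ⟨S, h2, h2', hbd⟩ := exists_edgeBoundary_subset_of_not_preconnected hcut
    have hle := card_edgeBoundary_le_ncard hbd
    obtain h | ⟨hbdcard, u, v, huv, hS⟩ := crossedCube_edgeBoundary hn S h2 h2'
    · omega
    have hmk : F.card * k = 2 * n - 2 := by omega
    have hsub : ∀ a b c : Fin n → Bool, (a = u ∧ b = v ∨ a = v ∧ b = u) →
        (crossedCube n).Adj a c → c ≠ b → ∃ e ∈ C, (e : Sym2 _) = s(a, c) := by
      intro a b c hab hac hcb
      have haS : a ∈ ({u, v} : Finset _) := by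
        rcases hab with ⟨rfl, _⟩ | ⟨rfl, _⟩ <;> simp
      have hcS : c ∉ ({u, v} : Finset _) := by
        have := hac.ne'
        rcases hab with ⟨rfl, rfl⟩ | ⟨rfl, rfl⟩ <;> simp [*]
      rcases hS with rfl | hS
      · exact hbd (a, c) (mem_edgeBoundary.2 ⟨hac, haS, hcS⟩)
      · rw [← hS, Finset.mem_compl] at haS hcS
        rw [not_not] at hcS
        obtain ⟨e, he, h⟩ := hbd (c, a) (mem_edgeBoundary.2 ⟨hac.symm, hcS, haS⟩)
        exact ⟨e, he, h.trans Sym2.eq_swap⟩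
    have hsubC : ∀ a b : Fin n → Bool, (a = u ∧ b = v ∨ a = v ∧ b = u) →
        edgesAtExcept (crossedCube n) a b ⊆ C := by
      rintro a b hab ⟨e, heG⟩ ⟨⟨c, rfl⟩, hb⟩
      obtain ⟨e, he, h⟩ := hsub a b c hab heG
        fun h => hb (h ▸ Sym2.mem_mk_right a c)
      rwa [← Subtype.ext (a1 := e) (a2 := ⟨s(a, c), heG⟩) h]
    have hA := ncard_edgesAtExcept crossedCube_neighborSet_ncard huv
    have hB := ncard_edgesAtExcept crossedCube_neighborSet_ncard huv.symm
    have hdisj : Disjoint (edgesAtExcept (crossedCube n) u v)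
        (edgesAtExcept (crossedCube n) v u) := by
      rw [Set.disjoint_left]
      exact fun e h1 h2 => h1.2 h2.1
    -- The union has `2n - 2` elements and lies in `C`, which has at most `|F| k = 2n - 2`.
    have hCeq : edgesAtExcept (crossedCube n) u v ∪ edgesAtExcept (crossedCube n) v u = C := by
      refine Set.eq_of_subset_of_ncard_le
        (Set.union_subset (hsubC u v (Or.inl ⟨rfl, rfl⟩)) (hsubC v u (Or.inr ⟨rfl, rfl⟩))) ?_
      rw [Set.ncard_union_eq hdisj, hA, hB]
      omega
    have hside : ∀ K ∈ F, K.verts ⊆ edgesAtExcept (crossedCube n) u v ∨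
        K.verts ⊆ edgesAtExcept (crossedCube n) v u := by
      intro K hK
      refine subset_of_preconnected (hconn K hK)
        (fun x hx y hy => not_adj_edgesAtExcept
          (fun _ _ _ => crossedCube_triangle_free) huv hx hy) ?_
      rw [hCeq]
      exact fun x hx => ⟨K, hK, hx⟩
    have hcA := ncard_le_card_mul_of_subset_biUnion
      (F.filter fun K => K.verts ⊆ edgesAtExcept (crossedCube n) u v)
      (fun K hK => hcard K (Finset.mem_filter.1 hK).1)
      (A := edgesAtExcept (crossedCube n) u v) (by
        intro x hx
        obtain ⟨K, hK, hxK⟩ := hsubC u v (Or.inl ⟨rfl, rfl⟩) hx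
        refine ⟨K, Finset.mem_filter.2 ⟨hK, (hside K hK).resolve_right fun h => ?_⟩, hxK⟩
        exact Set.disjoint_left.1 hdisj hx (h hxK))
    have hcB := ncard_le_card_mul_of_subset_biUnion
      (F.filter fun K => ¬ K.verts ⊆ edgesAtExcept (crossedCube n) u v)
      (fun K hK => hcard K (Finset.mem_filter.1 hK).1)
      (A := edgesAtExcept (crossedCube n) v u) (by
        intro x hx
        obtain ⟨K, hK, hxK⟩ := hsubC v u (Or.inr ⟨rfl, rfl⟩) hx
        refine ⟨K, Finset.mem_filter.2 ⟨hK, fun h => ?_⟩, hxK⟩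
        exact Set.disjoint_left.1 hdisj (h hxK) hx)
    have hsplit := Finset.card_filter_add_card_filter_not (s := F)
      (fun K => K.verts ⊆ edgesAtExcept (crossedCube n) u v)
    rw [hA] at hcA
    rw [hB] at hcB
    rw [← hsplit, add_mul] at hmk
    -- Each side needs at least `n - 1` from its own members and the total is `2n - 2`, so the side
    -- of `u` gets exactly `n - 1`, a multiple of `k`.
    refine hdvd (by rw [← hsplit, add_mul]; exact hmk) ⟨(F.filter fun K =>
      K.verts ⊆ edgesAtExcept (crossedCube n) u v).card, ?_⟩
    rw [mul_comm]
    omega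
  · have h1 := Set.ncard_add_ncard_compl C
    rw [hw, Set.ncard_singleton] at h1
    have h2 := crossedCube_edgeSet_ncard hn
    omega

/-! Structure cuts that isolate an edge. -/

section Windows

variable {W : Type*} {B : SimpleGraph W}

/-- The `k` consecutive vertices of a path that start at position `s` span a path. -/
theorem exists_subgraph_window {l : List W} (hl : l.Nodup) (hc : l.IsChain B.Adj) {s k : ℕ}
    (hsk : s + k ≤ l.length) :
    ∃ K : B.Subgraph, Nonempty (K.coe ≃g SimpleGraph.pathGraph k) ∧
      ∀ x, x ∈ K.verts ↔ ∃ (i : ℕ) (h : i < l.length), s ≤ i ∧ i < s + k ∧ l[i] = x := by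
  have hc' := List.isChain_iff_getElem.1 hc
  let f : SimpleGraph.Copy (SimpleGraph.pathGraph k) B :=
    ⟨⟨fun i => l[s + (i : ℕ)], by
      intro i j hij
      rcases SimpleGraph.pathGraph_adj.1 hij with h | h
      · have := hc' (s + i) (by omega)
        simpa [← h, add_assoc] using this
      · have := (hc' (s + j) (by omega)).symm
        simpa [← h, add_assoc] using this⟩, by
      intro i j hij
      have := (hl.getElem_inj_iff).1 (show l[s + (i : ℕ)] = l[s + (j : ℕ)] from hij)
      exact Fin.ext (by omega)⟩
  refine ⟨f.toSubgraph, ⟨f.isoToSubgraph.symm⟩, fun x => ?_⟩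
  simp only [SimpleGraph.Copy.toSubgraph, SimpleGraph.Subgraph.map_verts,
    SimpleGraph.Subgraph.verts_top, Set.image_univ, Set.mem_range]
  constructor
  · rintro ⟨i, rfl⟩
    exact ⟨s + i, by omega, by omega, by omega, rfl⟩
  · rintro ⟨i, h, h1, h2, rfl⟩
    refine ⟨⟨i - s, by omega⟩, ?_⟩
    change l[s + (i - s)] = l[i]
    congr 1
    omega

end Windows

/-- In a regular triangle-free graph with a 4-cycle, the neighbours of some vertex of the line
graph lie on a path with only one further vertex, the middle one. -/
theorem exists_path_through_neighbors {V : Type*} [Fintype V] {G : SimpleGraph V} {n : ℕ}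
    (hreg : ∀ v, (G.neighborSet v).ncard = n)
    {u v b a : V} (huv : G.Adj u v) (hvb : G.Adj v b) (hba : G.Adj b a) (hau : G.Adj a u)
    (hub : u ≠ b) (hva : v ≠ a) :
    ∃ l : List G.edgeSet, l.length = (n - 1) + 1 + (n - 1) ∧ l.Nodup ∧
      l.IsChain G.lineGraph.Adj ∧ (∀ e ∈ l, (e : Sym2 V) ≠ s(u, v)) ∧
      ∀ e : G.edgeSet, e ∈ edgesAtExcept G u v ∨ e ∈ edgesAtExcept G v u →
        ∃ (i : ℕ) (h : i < l.length), i ≠ n - 1 ∧ l[i] = e := by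
  classical
  set ua : G.edgeSet := ⟨s(u, a), hau.symm⟩ with hua
  set vb : G.edgeSet := ⟨s(v, b), hvb⟩ with hvb'
  set ab : G.edgeSet := ⟨s(a, b), hba.symm⟩ with hab
  set A := (edgesAtExcept G u v).toFinset with hA
  set B := (edgesAtExcept G v u).toFinset with hB
  have memA : ∀ e, e ∈ A ↔ u ∈ (e : Sym2 V) ∧ v ∉ (e : Sym2 V) := by
    simp [hA, mem_edgesAtExcept]
  have memB : ∀ e, e ∈ B ↔ v ∈ (e : Sym2 V) ∧ u ∉ (e : Sym2 V) := by
    simp [hB, mem_edgesAtExcept]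
  have huaA : ua ∈ A := by simp [memA, hua, huv.ne', hva]
  have hvbB : vb ∈ B := by simp [memB, hvb', huv.ne, hub]
  have habA : ab ∉ A := by simp [memA, hab, hau.ne', hub]
  have habB : ab ∉ B := by simp [memB, hab, hva, hvb.ne]
  have hAc : A.card = n - 1 := by
    rw [hA, ← Set.ncard_eq_toFinset_card', ncard_edgesAtExcept hreg huv]
  have hBc : B.card = n - 1 := by
    rw [hB, ← Set.ncard_eq_toFinset_card', ncard_edgesAtExcept hreg huv.symm]
  have hAB : ∀ e ∈ A, e ∉ B := fun e h1 h2 => ((memB e).1 h2).2 ((memA e).1 h1).1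
  -- Edges at one vertex are pairwise adjacent, so their order is free: `ua` is put last and `vb`
  -- first because `ab` meets both.
  set lA := (A.erase ua).toList ++ [ua] with hlA
  set lB := vb :: (B.erase vb).toList with hlB
  have memlA : ∀ e, e ∈ lA ↔ e ∈ A := by
    intro e
    by_cases h : e = ua <;> simp [hlA, h, huaA]
  have memlB : ∀ e, e ∈ lB ↔ e ∈ B := by
    intro e
    by_cases h : e = vb <;> simp [hlB, h, hvbB]
  have hlAlen : lA.length = n - 1 := by
    have := Finset.card_pos.2 ⟨ua, huaA⟩
    simp only [hlA, List.length_append, Finset.length_toList, Finset.card_erase_of_mem huaA,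
      List.length_singleton]
    omega
  have hlBlen : lB.length = n - 1 := by
    have := Finset.card_pos.2 ⟨vb, hvbB⟩
    simp only [hlB, Finset.length_toList, Finset.card_erase_of_mem hvbB,
      List.length_cons]
    omega
  have ndA : lA.Nodup := by
    rw [hlA, List.nodup_append']
    exact ⟨Finset.nodup_toList _, List.nodup_singleton _, by simp⟩
  have ndB : lB.Nodup := by
    rw [hlB, List.nodup_cons]
    exact ⟨by simp, Finset.nodup_toList _⟩
  have chain : ∀ (l : List G.edgeSet) (x : V), l.Nodup → (∀ e ∈ l, x ∈ (e : Sym2 V)) →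
      l.IsChain G.lineGraph.Adj := by
    intro l x hnd hx
    apply List.Pairwise.isChain
    refine List.Pairwise.imp_of_mem ?_ hnd
    intro e f he hf hne
    exact SimpleGraph.lineGraph_adj_iff_exists.2 ⟨hne, x, hx e he, hx f hf⟩
  refine ⟨lA ++ ab :: lB, ?_, ?_, ?_, ?_, ?_⟩
  · simp only [List.length_append, List.length_cons, hlAlen, hlBlen]; omega
  · rw [List.nodup_append', List.nodup_cons]
    refine ⟨ndA, ⟨by rwa [memlB], ndB⟩, ?_⟩
    intro e h1 h2
    rw [memlA] at h1
    rcases List.mem_cons.1 h2 with rfl | h2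
    · exact habA h1
    · exact hAB e h1 ((memlB e).1 h2)
  · rw [List.isChain_append]
    refine ⟨chain lA u ndA fun e he => ((memA e).1 ((memlA e).1 he)).1, ?_, ?_⟩
    · rw [hlB, List.isChain_cons_cons]
      refine ⟨?_, chain lB v ndB fun e he => ((memB e).1 ((memlB e).1 he)).1⟩
      exact SimpleGraph.lineGraph_adj_iff_exists.2
        ⟨fun h => habB (h ▸ hvbB), b, Sym2.mem_mk_right _ _, Sym2.mem_mk_right _ _⟩
    · intro x hx y hy
      simp only [hlA, List.getLast?_append, List.getLast?_singleton, Option.some_or,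
        Option.mem_def, Option.some.injEq, List.head?_cons] at hx hy
      subst hx hy
      exact SimpleGraph.lineGraph_adj_iff_exists.2
        ⟨fun h => habA (h ▸ huaA), a, Sym2.mem_mk_right _ _, Sym2.mem_mk_left _ _⟩
  · intro e he h
    rcases List.mem_append.1 he with he | he
    · rw [memlA, memA, h] at he
      exact he.2 (Sym2.mem_mk_right _ _)
    rcases List.mem_cons.1 he with rfl | he
    · have : u ∈ (ab : Sym2 V) := by rw [h]; exact Sym2.mem_mk_left _ _
      rcases Sym2.mem_iff.1 this with h | h
      · exact hau.ne h.symm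
      · exact hub h
    · rw [memlB, memB, h] at he
      exact he.2 (Sym2.mem_mk_left _ _)
  · rintro e (he | he)
    · have : e ∈ lA := by rw [memlA, memA]; exact he
      obtain ⟨i, hi, rfl⟩ := List.getElem_of_mem this
      exact ⟨i, by simp only [List.length_append]; omega, by omega,
        List.getElem_append_left hi⟩
    · have : e ∈ lB := by rw [memlB, memB]; exact he
      obtain ⟨i, hi, rfl⟩ := List.getElem_of_mem this
      refine ⟨n - 1 + 1 + i, by simp only [List.length_append, List.length_cons]; omega,
        by omega, ?_⟩
      rw [List.getElem_append_right (by omega)]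
      have : n - 1 + 1 + i - lA.length = i + 1 := by omega
      simp only [this, List.getElem_cons_succ]

/-- Windows of length `k` that cover `0, …, 2 n - 2`, except perhaps `n - 1`, yield a structure
cut of the line graph of the crossed cube. -/
theorem structureConnectivity_le_of_windows {n k m : ℕ} (hn : 4 ≤ n) (s : Fin m → ℕ)
    (hs : ∀ j, s j + k ≤ 2 * n - 1)
    (hcov : ∀ i < 2 * n - 1, i ≠ n - 1 → ∃ j, s j ≤ i ∧ i < s j + k) :
    structureConnectivity (crossedCube n).lineGraph (SimpleGraph.pathGraph k) ≤ m := by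
  classical
  obtain ⟨u, v, b, a, huv, hvb, hba, hau, hub, hva⟩ : ∃ u v b a : Fin n → Bool,
      (crossedCube n).Adj u v ∧ (crossedCube n).Adj v b ∧
      (crossedCube n).Adj b a ∧ (crossedCube n).Adj a u ∧ u ≠ b ∧ v ≠ a := by
    obtain ⟨p, rfl⟩ : ∃ p, n = p + 2 := ⟨n - 2, by omega⟩
    exact crossedCube_exists_four_cycle p
  obtain ⟨l, hlen, hnd, hch, hne, hlcov⟩ :=
    exists_path_through_neighbors crossedCube_neighborSet_ncard huv hvb hba hau hub hva
  have hlen' : l.length = 2 * n - 1 := by omega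
  choose K hK hKv using fun j => exists_subgraph_window hnd hch (k := k) (s := s j)
    (by rw [hlen']; exact hs j)
  have hF : IsStructureCut (crossedCube n).lineGraph (SimpleGraph.pathGraph k)
      (Set.range K) := by
    refine ⟨Or.inl fun hpre => ?_, by rintro _ ⟨j, rfl⟩; exact hK j⟩
    set C := coveredVerts (Set.range K) with hC
    have hCl : ∀ x ∈ C, x ∈ l := by
      rintro x ⟨_, ⟨j, rfl⟩, hx⟩
      obtain ⟨i, hi, _, _, rfl⟩ := (hKv j x).1 hx
      exact List.getElem_mem hi
    have hsubC : ∀ x, x ∈ edgesAtExcept (crossedCube n) u v ∨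
        x ∈ edgesAtExcept (crossedCube n) v u → x ∈ C := by
      intro x hx
      obtain ⟨i, hi, hin, rfl⟩ := hlcov x hx
      obtain ⟨j, hj1, hj2⟩ := hcov i (by omega) hin
      exact ⟨K j, ⟨j, rfl⟩, (hKv j _).2 ⟨i, hi, hj1, hj2, rfl⟩⟩
    set e : (crossedCube n).edgeSet := ⟨s(u, v), huv⟩ with he
    have heC : e ∉ C := fun h => hne e (hCl e h) rfl
    obtain ⟨f, hf⟩ : ∃ f, f ∉ (e :: l).toFinset := by
      by_contra! h
      have h1 := crossedCube_edgeSet_ncard hn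
      have h2 : (Finset.univ : Finset (crossedCube n).edgeSet) ⊆ (e :: l).toFinset :=
        fun x _ => h x
      have h3 := (Finset.card_le_card h2).trans (List.toFinset_card_le _)
      rw [Finset.card_univ, ← Nat.card_eq_fintype_card, List.length_cons] at h3
      omega
    rw [List.mem_toFinset, List.mem_cons, not_or] at hf
    have hfC : f ∉ C := fun h => hf.2 (hCl f h)
    obtain ⟨p⟩ := hpre ⟨e, heC⟩ ⟨f, hfC⟩
    -- The first step of a walk from `uv` to `f` would lead to an edge that meets `uv`, and all
    -- these are deleted.
    cases p with
    | nil => exact hf.1 rfl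
    | @cons _ g _ hadj _ =>
      rw [SimpleGraph.comap_adj] at hadj
      obtain ⟨hne', x, hx1, hx2⟩ := SimpleGraph.lineGraph_adj_iff_exists.1 hadj
      have hnot : ¬ (u ∈ (g.1 : Sym2 (Fin n → Bool)) ∧ v ∈ (g.1 : Sym2 (Fin n → Bool))) := by
        rintro h
        exact hne' (Subtype.ext ((Sym2.mem_and_mem_iff huv.ne).1 h).symm)
      refine g.2 (hsubC g.1 ?_)
      rw [mem_edgesAtExcept, mem_edgesAtExcept]
      rcases Sym2.mem_iff.1 hx1 with rfl | rfl
      · exact Or.inl ⟨hx2, fun h => hnot ⟨hx2, h⟩⟩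
      · exact Or.inr ⟨hx2, fun h => hnot ⟨h, hx2⟩⟩
  calc structureConnectivity (crossedCube n).lineGraph (SimpleGraph.pathGraph k)
      ≤ (Set.range K).encard := iInf₂_le _ hF
    _ ≤ (Set.univ : Set (Fin m)).encard := by
        rw [← Set.image_univ]; exact Set.encard_image_le _ _
    _ = m := by simp

/-! ### Comparison of both connectivities and the final values. -/

theorem IsStructureCut.isSubstructureCut {V W : Type*} {G : SimpleGraph V} {H : SimpleGraph W}
    (hH : H.Connected) {F : Set G.Subgraph} (hF : IsStructureCut G H F) :
    IsSubstructureCut G H F := by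
  refine ⟨hF.1, fun K hK => ⟨⊤, ?_, ?_⟩⟩
  · exact ⟨(SimpleGraph.Subgraph.topIso.connected_iff).2 hH⟩
  · obtain ⟨φ⟩ := hF.2 K hK
    exact ⟨φ.trans SimpleGraph.Subgraph.topIso.symm⟩

theorem substructureConnectivity_le_structureConnectivity {V W : Type*} (G : SimpleGraph V)
    {H : SimpleGraph W} (hH : H.Connected) :
    substructureConnectivity G H ≤ structureConnectivity G H :=
  le_iInf₂ fun _ hF => iInf₂_le _ (hF.isSubstructureCut hH)

/-- Turns the rational ceiling into the integer inequality used by both bounds. -/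
theorem ceil_two_mul_sub_one_div_le_iff {n k : ℕ} (hn : 1 ≤ n) (hk : 0 < k) (m : ℕ) :
    ⌈(2 * (n : ℚ) - 1) / (k : ℚ)⌉₊ ≤ m ↔ 2 * n - 1 ≤ m * k := by
  have hk' : (0 : ℚ) < k := by exact_mod_cast hk
  rw [Nat.ceil_le, div_le_iff₀ hk']
  have : 2 * (n : ℚ) - 1 = ((2 * n - 1 : ℕ) : ℚ) := by
    rw [Nat.cast_sub (by omega)]; push_cast; ring
  rw [this]
  exact_mod_cast Iff.rfl

theorem path_connectivity_lineGraph_crossedCube {n k : ℕ} (hn : 4 ≤ n) (hk : 4 ≤ k)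
    (hkn : k ≤ 2 * n - 1) :
    structureConnectivity (crossedCube n).lineGraph (SimpleGraph.pathGraph k) =
        substructureConnectivity (crossedCube n).lineGraph (SimpleGraph.pathGraph k) ∧
      substructureConnectivity (crossedCube n).lineGraph (SimpleGraph.pathGraph k) =
        ((if k ≤ n - 1 ∧ k ∣ n - 1 then (2 * n - 2) / k
          else ⌈(2 * (n : ℚ) - 1) / (k : ℚ)⌉₊ : ℕ) : ℕ∞) := by
  have hconn : (SimpleGraph.pathGraph k).Connected := by
    obtain ⟨j, rfl⟩ : ∃ j, k = j + 1 := ⟨k - 1, by omega⟩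
    exact SimpleGraph.pathGraph_connected j
  have hle := substructureConnectivity_le_structureConnectivity
    (crossedCube n).lineGraph hconn
  have hupper : structureConnectivity (crossedCube n).lineGraph (SimpleGraph.pathGraph k) ≤
      ((if k ≤ n - 1 ∧ k ∣ n - 1 then (2 * n - 2) / k
          else ⌈(2 * (n : ℚ) - 1) / (k : ℚ)⌉₊ : ℕ) : ℕ∞) := by
    split_ifs with h
    · obtain ⟨-, q, hq⟩ := h
      have hm : (2 * n - 2) / k = 2 * q := by
        rw [show 2 * n - 2 = k * (2 * q) by rw [mul_left_comm, ← hq]; omega]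
        exact Nat.mul_div_cancel_left _ (by omega)
      rw [hm]
      refine structureConnectivity_le_of_windows hn
        -- With `n - 1 = kq`, `q` windows tile `0, …, n - 2` and `q` tile `n, …, 2n - 2`, skipping
        -- the middle index `n - 1`.
        (fun j : Fin (2 * q) => if (j : ℕ) < q then k * j else n + k * (j - q)) ?_ ?_
      · intro j
        split_ifs with hj
        · have : k * (j + 1) ≤ k * q := Nat.mul_le_mul_left _ hj
          rw [mul_add, mul_one] at this
          omega
        · have : k * ((j - q) + 1) ≤ k * q := Nat.mul_le_mul_left _ (by omega)
          rw [mul_add, mul_one] at this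
          omega
      · intro i hi hin
        rcases Nat.lt_or_ge i (n - 1) with h | h
        · have hdiv : i / k < q := Nat.div_lt_of_lt_mul (by omega)
          have h1 := Nat.div_add_mod i k
          have h2 := Nat.mod_lt i (show 0 < k by omega)
          refine ⟨⟨i / k, by omega⟩, ?_⟩
          simp only [if_pos hdiv]
          omega
        · have hdiv : (i - n) / k < q := Nat.div_lt_of_lt_mul (by omega)
          have h1 := Nat.div_add_mod (i - n) k
          have h2 := Nat.mod_lt (i - n) (show 0 < k by omega)
          generalize (i - n) / k = t at hdiv h1
          refine ⟨⟨q + t, by omega⟩, ?_⟩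
          simp only [if_neg (show ¬ q + t < q by omega), Nat.add_sub_cancel_left]
          omega
    · have hm := (ceil_two_mul_sub_one_div_le_iff (by omega : 1 ≤ n) (by omega : 0 < k) _).1
        le_rfl
      set m := ⌈(2 * (n : ℚ) - 1) / (k : ℚ)⌉₊ with hmdef
      refine structureConnectivity_le_of_windows hn
        -- Consecutive windows, the last pushed back to end inside the path; members of a cut may
        -- overlap.
        (fun j : Fin m => min (k * j) (2 * n - 1 - k)) ?_ ?_
      · intro j
        omega
      · intro i hi _
        have hdiv : i / k < m := Nat.div_lt_of_lt_mul (by rw [mul_comm]; omega)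
        have h1 := Nat.div_add_mod i k
        have h2 := Nat.mod_lt i (show 0 < k by omega)
        refine ⟨⟨i / k, hdiv⟩, ?_⟩
        dsimp only
        omega
  have hlower : ((if k ≤ n - 1 ∧ k ∣ n - 1 then (2 * n - 2) / k
          else ⌈(2 * (n : ℚ) - 1) / (k : ℚ)⌉₊ : ℕ) : ℕ∞) ≤
      substructureConnectivity (crossedCube n).lineGraph (SimpleGraph.pathGraph k) := by
    refine le_iInf₂ fun F hF => ?_
    rcases F.finite_or_infinite with hfin | hinf
    · rw [← hfin.cast_ncard_eq, Nat.cast_le]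
      rcases le_ncard_mul_of_isSubstructureCut hn hF hfin with h | ⟨h, hdvd⟩
      · split_ifs
        · exact Nat.div_le_of_le_mul (by rw [mul_comm k]; omega)
        · exact (ceil_two_mul_sub_one_div_le_iff (by omega) (by omega) _).2 h
      -- The exceptional size `2n - 2` occurs only in the first case of the formula.
      · rw [if_pos ⟨Nat.le_of_dvd (by omega) hdvd, hdvd⟩]
        exact Nat.div_le_of_le_mul (by rw [mul_comm k]; omega)
    · rw [hinf.encard_eq]
      exact le_top
  have h2 := le_antisymm (hle.trans hupper) hlower
  exact ⟨le_antisymm (hupper.trans hlower) hle, h2⟩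

theorem theorem4p11 (n k : ℕ) (hn : 4 ≤ n) (hk : 4 ≤ k) (hkn : k ≤ 2 * n - 1) :
    structureConnectivity (bcdc n) (SimpleGraph.pathGraph k) =
        substructureConnectivity (bcdc n) (SimpleGraph.pathGraph k) ∧
      substructureConnectivity (bcdc n) (SimpleGraph.pathGraph k) =
        ((if k ≤ n - 1 ∧ k ∣ n - 1 then (2 * n - 2) / k
          else ⌈(2 * (n : ℚ) - 1) / (k : ℚ)⌉₊ : ℕ) : ℕ∞) := by
  have hverts : bcdcVerts n = (crossedCube n).edgeSet := by
    obtain ⟨p, rfl⟩ : ∃ p, n = p + 2 := ⟨n - 2, by omega⟩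
    exact bcdcVerts_eq_edgeSet p
  have hadj : ∀ e f : bcdcVerts n, (bcdc n).Adj e f ↔
      e ≠ f ∧ ∃ v, v ∈ (e : Sym2 (Fin n → Bool)) ∧ v ∈ (f : Sym2 (Fin n → Bool)) := by
    obtain ⟨p, rfl⟩ : ∃ p, n = p + 2 := ⟨n - 2, by omega⟩
    intro e f
    rw [bcdc, SimpleGraph.comap_adj]
    refine (bcdcEdges_adj p e f).trans ?_
    rw [Ne, Ne, Subtype.ext_iff]
    exact ⟨fun h => h.2.2, fun h => ⟨e.2, f.2, h⟩⟩
  -- The vertex set occurs in the type of the graph, so both become variables before the set is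
  -- replaced by the edge set of `CQ_n`.
  generalize bcdc n = B at *
  generalize bcdcVerts n = U at *
  subst hverts
  obtain rfl : B = (crossedCube n).lineGraph := by
    ext e f
    rw [hadj, SimpleGraph.lineGraph_adj_iff_exists]
  exact path_connectivity_lineGraph_crossedCube hn hk hkn
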